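/- Let $\mathbb F=\mathbb C(X,Y)$ be the free skew field, i.e. the skew field of rational functions in two non-commutative variables $X,Y$ (the universal field of fractions of the free algebra $\mathbb C\langle X,Y\rangle$), and let $C=XYX^{-1}Y^{-1}$. Consider the non-commutative $(1,4)$ system for a sequence $(R_n)_{n\in\mathbb Z}$ in $\mathbb F$: $$R_{n+1}\,C\,R_{n-1}=\begin{cases}1+R_n, & n\ \text{odd},\\ 1+R_n^4, & n\ \text{even},\end{cases}\qquad n\in\mathbb Z,$$ with initial data $CR_1=X$, $R_2=Y$ (equivalently $R_1=YXY^{-1}$, $R_2=Y$). This system has a unique solution $(R_n)_{n\in\mathbb Z}$ in $\mathbb F$, and for every $n\ge 0$ the element $R_n$ is a non-commutative Laurent polynomial in $X,Y$ with only non-negative integer coefficients, i.e. a finite sum of words in $X,X^{-1},Y,Y^{-1}$ with coefficients in $\mathbb Z_{\ge 0}$. -/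

import Mathlib

namespace NCCluster

/-- The free associative algebra `ℂ⟨X, Y⟩`; the index `0` stands for `X`, the index `1` for `Y`. -/
abbrev FreeAlg : Type := FreeAlgebra ℂ (Fin 2)

/-- A square matrix over `ℂ⟨X, Y⟩` is full if it has no factorization through a smaller size. -/
def IsFull {n : ℕ} (M : Matrix (Fin n) (Fin n) FreeAlg) : Prop :=
  ∀ (m : ℕ) (P : Matrix (Fin n) (Fin m) FreeAlg) (Q : Matrix (Fin m) (Fin n) FreeAlg),
    M = P * Q → n ≤ m

/-- The full matrices over `ℂ⟨X, Y⟩`, of all sizes. -/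
structure FullMatrix : Type where
  size : ℕ
  mat : Matrix (Fin size) (Fin size) FreeAlg
  full : IsFull mat

/-- Generators of the free skew field: the two variables, and the entries of a formal inverse
of every full matrix. -/
inductive Gen : Type
  | var (i : Fin 2) : Gen
  | inv (M : FullMatrix) (i j : Fin M.size) : Gen

/-- The algebra homomorphism `ℂ⟨X, Y⟩ → ℂ⟨Gen⟩` that sends variables to variables. -/
noncomputable def embed : FreeAlg →ₐ[ℂ] FreeAlgebra ℂ Gen :=
  FreeAlgebra.lift ℂ fun i => FreeAlgebra.ι ℂ (Gen.var i)

/-- The relations `M * M⁻¹ = 1` and `M⁻¹ * M = 1`, entry by entry, for every full matrix `M`. -/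
inductive Rel : FreeAlgebra ℂ Gen → FreeAlgebra ℂ Gen → Prop
  | mul_inv (M : FullMatrix) (i j : Fin M.size) :
      Rel (∑ k, embed (M.mat i k) * FreeAlgebra.ι ℂ (Gen.inv M k j)) (if i = j then 1 else 0)
  | inv_mul (M : FullMatrix) (i j : Fin M.size) :
      Rel (∑ k, FreeAlgebra.ι ℂ (Gen.inv M i k) * embed (M.mat k j)) (if i = j then 1 else 0)

/-- The skew field `ℂ(X, Y)` of rational functions in two non-commutative variables (the free
skew field), that is, the universal field of fractions of `ℂ⟨X, Y⟩`, in P. M. Cohn's construction: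
the universal localization of `ℂ⟨X, Y⟩` that inverts all full matrices. -/
def FreeSkewField : Type := RingQuot Rel

noncomputable instance : Ring FreeSkewField := inferInstanceAs (Ring (RingQuot Rel))

noncomputable instance : Algebra ℂ FreeSkewField := inferInstanceAs (Algebra ℂ (RingQuot Rel))

/-- The projection from the free algebra on all generators. -/
noncomputable def proj : FreeAlgebra ℂ Gen →ₐ[ℂ] FreeSkewField := RingQuot.mkAlgHom ℂ Rel

theorem proj_rel {a b : FreeAlgebra ℂ Gen} (h : Rel a b) : proj a = proj b :=
  RingQuot.mkAlgHom_rel ℂ h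

/-- A variable, as a `1 × 1` full matrix. -/
noncomputable def varMatrix (i : Fin 2) : FullMatrix where
  size := 1
  mat := fun _ _ => FreeAlgebra.ι ℂ i
  full := by
    intro m P Q h
    by_contra hm
    obtain rfl : m = 0 := by omega
    have h0 := congrFun (congrFun h 0) 0
    simp [Matrix.mul_apply] at h0

/-- The variables, as invertible elements of the free skew field. -/
noncomputable def gen (i : Fin 2) : FreeSkewFieldˣ where
  val := proj (FreeAlgebra.ι ℂ (Gen.var i))
  inv := proj (FreeAlgebra.ι ℂ (Gen.inv (varMatrix i) (0 : Fin 1) (0 : Fin 1)))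
  val_inv := by
    have h := proj_rel (Rel.mul_inv (varMatrix i) (0 : Fin 1) (0 : Fin 1))
    have e : ∀ f : Fin (varMatrix i).size → FreeAlgebra ℂ Gen, ∑ k, f k = f (0 : Fin 1) :=
      fun f => Fin.sum_univ_one f
    rw [e] at h
    simpa [embed, varMatrix] using h
  inv_val := by
    have h := proj_rel (Rel.inv_mul (varMatrix i) (0 : Fin 1) (0 : Fin 1))
    have e : ∀ f : Fin (varMatrix i).size → FreeAlgebra ℂ Gen, ∑ k, f k = f (0 : Fin 1) :=
      fun f => Fin.sum_univ_one f
    rw [e] at h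
    simpa [embed, varMatrix] using h

/-- The variable `X`. -/
noncomputable def X : FreeSkewFieldˣ := gen 0

/-- The variable `Y`. -/
noncomputable def Y : FreeSkewFieldˣ := gen 1

/-- The commutator `C = X Y X⁻¹ Y⁻¹`. -/
noncomputable def C : FreeSkewFieldˣ := X * Y * X⁻¹ * Y⁻¹

/-- `R` is a solution of the non-commutative `(b, c)` system
`R (n + 1) C R (n - 1) = 1 + (R n) ^ b` for `n` odd, `= 1 + (R n) ^ c` for `n` even. -/
structure IsSolution (b c : ℕ) (R : ℤ → FreeSkewField) : Prop where
  odd : ∀ n : ℤ, Odd n → R (n + 1) * (C : FreeSkewField) * R (n - 1) = 1 + R n ^ b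
  even : ∀ n : ℤ, Even n → R (n + 1) * (C : FreeSkewField) * R (n - 1) = 1 + R n ^ c

/-- The initial data `(C R₁, R₂) = (X, Y)`. -/
def HasInitialData (R : ℤ → FreeSkewField) : Prop :=
  (C : FreeSkewField) * R 1 = X ∧ R 2 = Y

/-- The non-commutative Laurent monomial given by a word in `X`, `X⁻¹`, `Y`, `Y⁻¹`, that is, by an
element of the free group on two letters. -/
noncomputable def monomial : FreeGroup (Fin 2) →* FreeSkewFieldˣ := FreeGroup.lift gen

/-- `r` is a non-commutative Laurent polynomial in `X`, `Y` with non-negative integer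
coefficients: a finite sum of Laurent monomials with coefficients in `ℕ`. -/
def IsPositiveLaurent (r : FreeSkewField) : Prop :=
  ∃ p : FreeGroup (Fin 2) →₀ ℕ, r = p.sum fun w k => k • (monomial w : FreeSkewField)

end NCCluster

/-! Write o_k = R_{2k-1} and e_k = R_{2k}.

Existence and uniqueness only need every term to be a unit. An element given as c A⁻¹ b over the
free algebra is a unit as soon as the same expression has a nonzero value at X = Y = 1
(`HasValue.isUnit`). Units with a positive value form a group closed under addition, so the
recursion runs inside it in both directions.

For positivity, the relations o e = e C o and e o = o C e between neighbours propagate forward and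
make `conserved` constant along the solution. With K its value, the even terms satisfy the linear
recurrence e_{k+2} = K e_{k+1} - C e_k. Here K = a + c + δ, with a, c monomials, c a = C and δ
positive. Hence h_k = e_{k+1} - a e_k obeys h_{k+1} = c h_k + δ e_{k+1}, which has no signs, so all
e_k are positive. Finally o_{k+1} = e_{k+1} C e_k - 1, and the -1 cancels against a product of
explicit monomials in e_{k+1} and e_k. -/

namespace NCCluster

/-! ### Linear realizations and units of the free skew field -/

section Realization

open Matrix

/-- The canonical map `ℂ⟨X, Y⟩ → ℂ(X, Y)`. -/
noncomputable def toSkewField : FreeAlg →+* FreeSkewField := (proj.comp embed).toRingHom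

/-- The evaluation `ℂ⟨X, Y⟩ → ℂ` at `X = Y = 1`. -/
noncomputable def evalOne : FreeAlg →+* ℂ := (FreeAlgebra.lift ℂ fun _ => (1 : ℂ)).toRingHom

/-- A factorization through size m bounds the rank of the image over K by m, while an invertible
image has rank n. -/
theorem isFull_of_isUnit_map {n : ℕ} {K : Type*} [Field K] (φ : FreeAlg →+* K)
    (M : Matrix (Fin n) (Fin n) FreeAlg) (h : IsUnit (M.map φ)) : IsFull M := by
  intro m P Q hM
  have hr := Matrix.rank_of_isUnit _ h
  rw [hM, Matrix.map_mul, Fintype.card_fin] at hr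
  rw [← hr]
  refine (Matrix.rank_mul_le_left _ _).trans ?_
  simpa using Matrix.rank_le_card_width (P.map φ)

theorem isUnit_map_of_isFull {n : ℕ} (M : Matrix (Fin n) (Fin n) FreeAlg) (h : IsFull M) :
    IsUnit (M.map toSkewField) := by
  let F : FullMatrix := ⟨n, M, h⟩
  let N : Matrix (Fin n) (Fin n) FreeSkewField :=
    fun i j => proj (FreeAlgebra.ι ℂ (Gen.inv F i j))
  refine isUnit_iff_exists.2 ⟨N, ?_, ?_⟩
  · ext i j
    have := proj_rel (Rel.mul_inv F i j)
    rw [map_sum] at this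
    simp only [map_mul] at this
    rw [Matrix.mul_apply, Matrix.one_apply]
    refine Eq.trans this ?_
    change proj (if i = j then 1 else 0) = _
    split_ifs <;> simp
  · ext i j
    have := proj_rel (Rel.inv_mul F i j)
    rw [map_sum] at this
    simp only [map_mul] at this
    rw [Matrix.mul_apply, Matrix.one_apply]
    refine Eq.trans this ?_
    change proj (if i = j then 1 else 0) = _
    split_ifs <;> simp

theorem isUnit_map_of_isUnit_evalOne {ι : Type*} [Fintype ι] [DecidableEq ι]
    (M : Matrix ι ι FreeAlg) (h : IsUnit (M.map evalOne)) : IsUnit (M.map toSkewField) := by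
  let e := Fintype.equivFin ι
  have h1 : IsUnit ((M.submatrix e.symm e.symm).map evalOne) := by
    have := h.map (Matrix.reindexAlgEquiv ℂ ℂ e)
    simpa [Matrix.submatrix_map] using this
  have h2 := isUnit_map_of_isFull _ (isFull_of_isUnit_map evalOne _ h1)
  have := h2.map (Matrix.reindexAlgEquiv ℂ FreeSkewField e.symm)
  simpa [Matrix.submatrix_map] using this

/-- The element `x` is `c A⁻¹ b` in the ring `K`. -/
def IsRealized {ι R K : Type*} [Fintype ι] [DecidableEq ι] [Ring R] [Ring K] (φ : R →+* K)
    (A : Matrix ι ι R) (b : Matrix ι Unit R) (c : Matrix Unit ι R) (x : K) : Prop :=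
  ∃ N : Matrix ι ι K, A.map φ * N = 1 ∧ N * A.map φ = 1 ∧
    c.map φ * N * b.map φ = Matrix.scalar Unit x

section

variable {ι κ R K : Type*} [Fintype ι] [DecidableEq ι] [Fintype κ] [DecidableEq κ] [Ring R] [Ring K]
  {φ : R →+* K} {A : Matrix ι ι R} {b : Matrix ι Unit R} {c : Matrix Unit ι R} {x : K}
  {A' : Matrix κ κ R} {b' : Matrix κ Unit R} {c' : Matrix Unit κ R} {x' : K}

theorem IsRealized.map (φ : R →+* K) (r : R) :
    IsRealized φ (1 : Matrix Unit Unit R) 1 (Matrix.scalar Unit r) (φ r) := by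
  refine ⟨1, ?_, ?_, ?_⟩
  · simp
  · simp
  · simp

theorem IsRealized.add (h : IsRealized φ A b c x) (h' : IsRealized φ A' b' c' x') :
    IsRealized φ (fromBlocks A 0 0 A') (fromRows b b') (fromCols c c') (x + x') := by
  obtain ⟨N, h1, h2, h3⟩ := h
  obtain ⟨N', h1', h2', h3'⟩ := h'
  refine ⟨fromBlocks N 0 0 N', ?_, ?_, ?_⟩
  · simp [fromBlocks_map, fromBlocks_multiply, h1, h1']
  · simp [fromBlocks_map, fromBlocks_multiply, h2, h2']
  · rw [map_add, ← h3, ← h3', fromCols_map, fromRows_map, fromCols_mul_fromBlocks,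
      fromCols_mul_fromRows]
    simp

theorem IsRealized.mul (h : IsRealized φ A b c x) (h' : IsRealized φ A' b' c' x') :
    IsRealized φ (fromBlocks A (-(b * c')) 0 A') (fromRows 0 b') (fromCols c 0) (x * x') := by
  obtain ⟨N, h1, h2, h3⟩ := h
  obtain ⟨N', h1', h2', h3'⟩ := h'
  have hb : (-(b * c')).map φ = -(b.map φ * c'.map φ) := by
    rw [← Matrix.map_mul]
    exact Matrix.map_neg _ (map_neg φ) _
  refine ⟨fromBlocks N (N * (b.map φ * c'.map φ) * N') 0 N', ?_, ?_, ?_⟩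
  · rw [fromBlocks_map, fromBlocks_multiply, hb]
    simp [← Matrix.mul_assoc, h1, h1']
  · rw [fromBlocks_map, fromBlocks_multiply, hb]
    simp [Matrix.mul_assoc, h2, h2']
  · rw [map_mul, ← h3, ← h3', fromCols_map, fromRows_map, fromCols_mul_fromBlocks,
      fromCols_mul_fromRows]
    simp [Matrix.mul_assoc]

/-- The bordered matrix has Schur complement -x, so the corner of its inverse is -x⁻¹; the entry -1
in the row corrects the sign. -/
theorem IsRealized.inv {u : Kˣ} (h : IsRealized φ A b c u) :
    IsRealized φ (fromBlocks A b c 0) (fromRows 0 1) (fromCols 0 (-1)) (↑u⁻¹ : K) := by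
  obtain ⟨N, h1, h2, h3⟩ := h
  set y : Matrix Unit Unit K := Matrix.scalar Unit (↑u⁻¹ : K)
  have hy1 : c.map φ * (N * (b.map φ * y)) = 1 := by
    rw [← Matrix.mul_assoc, ← Matrix.mul_assoc, h3, ← map_mul]; simp
  have hy2 : y * (c.map φ * (N * b.map φ)) = 1 := by
    rw [← Matrix.mul_assoc (c.map φ), h3, ← map_mul]; simp
  have hn : ((-1 : Matrix Unit Unit R).map φ) = -1 := by
    ext; simp
  refine ⟨fromBlocks (N - N * (b.map φ * (y * (c.map φ * N)))) (N * (b.map φ * y))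
    (y * (c.map φ * N)) (-y), ?_, ?_, ?_⟩
  · rw [fromBlocks_map, fromBlocks_multiply, ← fromBlocks_one]
    congr 1
    · simp [Matrix.mul_sub, ← Matrix.mul_assoc, h1]
    · simp [← Matrix.mul_assoc, h1]
    · have : c.map φ * (N * (b.map φ * (y * (c.map φ * N)))) = c.map φ * N := by
        have := congrArg (· * (c.map φ * N)) hy1
        simpa [Matrix.mul_assoc] using this
      simp [Matrix.mul_sub, this]
    · simp [hy1]
  · rw [fromBlocks_map, fromBlocks_multiply, ← fromBlocks_one]
    congr 1
    · simp [Matrix.sub_mul, Matrix.mul_assoc, h2]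
    · have : N * (b.map φ * (y * (c.map φ * (N * b.map φ)))) = N * b.map φ := by
        rw [hy2, Matrix.mul_one]
      simp [Matrix.sub_mul, Matrix.mul_assoc, this]
    · simp [Matrix.mul_assoc, h2]
    · simp [Matrix.mul_assoc, hy2]
  · rw [fromCols_map, fromRows_map, fromCols_mul_fromBlocks, fromCols_mul_fromRows, hn]
    simp [y]

theorem IsRealized.isUnit_fromBlocks_iff (h : IsRealized φ A b c x) :
    IsUnit ((fromBlocks A b c 0).map φ) ↔ IsUnit x := by
  constructor
  · intro hu
    obtain ⟨N, h1, h2, h3⟩ := h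
    rw [fromBlocks_map] at hu
    obtain ⟨M, hM, hM'⟩ := isUnit_iff_exists.1 hu
    rw [← fromBlocks_toBlocks M, fromBlocks_multiply, ← fromBlocks_one, fromBlocks_inj] at hM hM'
    obtain ⟨-, h12, -, h22⟩ := hM
    obtain ⟨-, -, h21', h22'⟩ := hM'
    set q := M.toBlocks₁₂
    set s := M.toBlocks₂₁
    set t := M.toBlocks₂₂
    have hq : q = -(N * b.map φ * t) := by
      have := congrArg (N * ·) h12
      simp only [Matrix.mul_add, ← Matrix.mul_assoc, h2, Matrix.one_mul, Matrix.mul_zero] at this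
      exact eq_neg_of_add_eq_zero_left this
    have hs : s = -(t * c.map φ * N) := by
      have := congrArg (· * N) h21'
      simp only [Matrix.add_mul, Matrix.mul_assoc, h1, Matrix.mul_one, Matrix.zero_mul] at this
      rw [Matrix.mul_assoc]
      exact eq_neg_of_add_eq_zero_left this
    have e1 : Matrix.scalar Unit x * -t = 1 := by
      rw [hq] at h22
      rw [← h3, ← h22]
      simp [Matrix.mul_assoc]
    have e2 : -t * Matrix.scalar Unit x = 1 := by
      rw [hs] at h22'
      rw [← h3, ← h22']
      simp [Matrix.mul_assoc]
    refine isUnit_iff_exists.2 ⟨-t () (), ?_, ?_⟩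
    · simpa [Matrix.mul_apply] using congrFun (congrFun e1 ()) ()
    · simpa [Matrix.mul_apply] using congrFun (congrFun e2 ()) ()
  · rintro ⟨u, rfl⟩
    obtain ⟨N, h1, h2, -⟩ := h.inv
    exact isUnit_iff_exists.2 ⟨N, h1, h2⟩

end

/-- The pair `(r, z)` has a common realization `c A⁻¹ b` over `ℂ⟨X, Y⟩`, where `z` is the value of
`r` at `X = Y = 1`. -/
def HasValue (r : FreeSkewField) (z : ℂ) : Prop :=
  ∃ (ι : Type) (_ : Fintype ι) (_ : DecidableEq ι) (A : Matrix ι ι FreeAlg)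
    (b : Matrix ι Unit FreeAlg) (c : Matrix Unit ι FreeAlg),
    IsRealized toSkewField A b c r ∧ IsRealized evalOne A b c z

theorem HasValue.of (a : FreeAlg) : HasValue (toSkewField a) (evalOne a) :=
  ⟨Unit, _, inferInstance, _, _, _, .map _ _, .map _ _⟩

theorem HasValue.one : HasValue 1 1 := by
  simpa using HasValue.of 1

theorem HasValue.add {r r' : FreeSkewField} {z z' : ℂ} (h : HasValue r z) (h' : HasValue r' z') :
    HasValue (r + r') (z + z') := by
  obtain ⟨ι, _, _, A, b, c, h1, h2⟩ := h
  obtain ⟨κ, _, _, A', b', c', h1', h2'⟩ := h'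
  exact ⟨ι ⊕ κ, inferInstance, inferInstance, _, _, _, h1.add h1', h2.add h2'⟩

theorem HasValue.mul {r r' : FreeSkewField} {z z' : ℂ} (h : HasValue r z) (h' : HasValue r' z') :
    HasValue (r * r') (z * z') := by
  obtain ⟨ι, _, _, A, b, c, h1, h2⟩ := h
  obtain ⟨κ, _, _, A', b', c', h1', h2'⟩ := h'
  exact ⟨ι ⊕ κ, inferInstance, inferInstance, _, _, _, h1.mul h1', h2.mul h2'⟩

/-- The bordered matrix is invertible at X = Y = 1, hence full, hence invertible over the free skew
field, and so is its Schur complement -r. -/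
theorem HasValue.isUnit {r : FreeSkewField} {z : ℂ} (h : HasValue r z) (hz : z ≠ 0) :
    IsUnit r := by
  obtain ⟨ι, _, _, A, b, c, h1, h2⟩ := h
  exact h1.isUnit_fromBlocks_iff.1
    (isUnit_map_of_isUnit_evalOne _ (h2.isUnit_fromBlocks_iff.2 hz.isUnit))

theorem HasValue.inv {u : FreeSkewFieldˣ} {z : ℂ} (h : HasValue u z) (hz : z ≠ 0) :
    HasValue (↑u⁻¹ : FreeSkewField) z⁻¹ := by
  obtain ⟨ι, _, _, A, b, c, h1, h2⟩ := h
  exact ⟨ι ⊕ Unit, inferInstance, inferInstance, _, _, _, h1.inv,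
    IsRealized.inv (u := Units.mk0 z hz) h2⟩

/-- The units of the free skew field with a positive value at `X = Y = 1`. -/
noncomputable def positiveUnits : Subgroup FreeSkewFieldˣ where
  carrier := {u | ∃ q : ℝ, 0 < q ∧ HasValue u q}
  one_mem' := ⟨1, one_pos, by simpa using HasValue.one⟩
  mul_mem' := by
    rintro u v ⟨p, hp, hu⟩ ⟨q, hq, hv⟩
    exact ⟨p * q, mul_pos hp hq, by simpa using hu.mul hv⟩
  inv_mem' := by
    rintro u ⟨p, hp, hu⟩
    exact ⟨p⁻¹, inv_pos.2 hp, by simpa using hu.inv (by exact_mod_cast hp.ne')⟩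

theorem exists_mem_positiveUnits_eq_add {u v : FreeSkewFieldˣ} (hu : u ∈ positiveUnits)
    (hv : v ∈ positiveUnits) :
    ∃ w ∈ positiveUnits, (w : FreeSkewField) = u + v := by
  obtain ⟨p, hp, hu⟩ := hu
  obtain ⟨q, hq, hv⟩ := hv
  have h := hu.add hv
  have hpq : 0 < p + q := add_pos hp hq
  obtain ⟨w, hw⟩ := h.isUnit (by exact_mod_cast hpq.ne')
  exact ⟨w, ⟨p + q, hpq, by rw [hw]; simpa using h⟩, hw⟩

theorem gen_mem_positiveUnits (i : Fin 2) : gen i ∈ positiveUnits := by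
  refine ⟨1, one_pos, ?_⟩
  have := HasValue.of (FreeAlgebra.ι ℂ i)
  simpa [toSkewField, evalOne, embed, gen] using this

end Realization

/-! ### The semiring of positive Laurent polynomials -/

/-- The Laurent polynomials in `X`, `Y` with coefficients in `ℕ`, as a subsemiring. -/
noncomputable def positiveLaurent : Subsemiring FreeSkewField :=
  (MonoidAlgebra.lift ℕ FreeSkewField (FreeGroup (Fin 2))
    ((Units.coeHom FreeSkewField).comp monomial)).toRingHom.rangeS

theorem isPositiveLaurent_iff {r : FreeSkewField} :
    IsPositiveLaurent r ↔ r ∈ positiveLaurent := by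
  constructor
  · rintro ⟨p, rfl⟩
    exact ⟨⟨p⟩, MonoidAlgebra.lift_apply _ _⟩
  · rintro ⟨p, rfl⟩
    exact ⟨p.coeff, MonoidAlgebra.lift_apply _ _⟩

theorem coe_mem_positiveLaurent_of_mem_range {u : FreeSkewFieldˣ} (hu : u ∈ monomial.range) :
    (u : FreeSkewField) ∈ positiveLaurent := by
  obtain ⟨w, rfl⟩ := hu
  exact ⟨MonoidAlgebra.single w 1, by simp⟩

theorem gen_mem_range_monomial (i : Fin 2) : gen i ∈ monomial.range :=
  ⟨FreeGroup.of i, by simp [monomial]⟩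

/-! ### Existence and uniqueness of the solution -/

section Existence

variable {A : Type*} [Ring A] (C : Aˣ)

/-- The system for the terms `o k` of index `2 k - 1` and `e k` of index `2 k`. -/
structure IsPairSolution (C : Aˣ) (o e : ℤ → A) : Prop where
  even : ∀ k, o (k + 1) * C * o k = 1 + e k ^ 4
  odd : ∀ k, e (k + 1) * C * e k = 1 + o (k + 1)

theorem exists_isPairSolution (S : Subgroup Aˣ)
    (hS : ∀ u ∈ S, ∀ v ∈ S, ∃ w ∈ S, (w : A) = u + v) (hC : C ∈ S) {x y : Aˣ} (hx : x ∈ S)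
    (hy : y ∈ S) :
    ∃ o e : ℤ → Aˣ, IsPairSolution C (fun k => (o k : A)) (fun k => (e k : A)) ∧
      o 1 = x ∧ e 1 = y := by
  have h1 : ∀ u : S, ∃ w : S, ((w : Aˣ) : A) = 1 + ((u : Aˣ) : A) := fun u => by
    obtain ⟨w, hw, h⟩ := hS 1 S.one_mem u u.2
    exact ⟨⟨w, hw⟩, by simpa using h⟩
  choose f hf using h1
  let c : S := ⟨C, hC⟩
  -- The shift (o k, e k) ↦ (o (k + 1), e (k + 1)); being invertible, it has iterates of every
  -- integer order.
  let T : Equiv.Perm (S × S) :=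
    { toFun := fun p => (f (p.2 ^ 4) * p.1⁻¹ * c⁻¹,
        f (f (p.2 ^ 4) * p.1⁻¹ * c⁻¹) * p.2⁻¹ * c⁻¹)
      invFun := fun p => (c⁻¹ * p.1⁻¹ * f ((c⁻¹ * p.2⁻¹ * f p.1) ^ 4), c⁻¹ * p.2⁻¹ * f p.1)
      left_inv := fun p => by ext1 <;> simp [mul_assoc]
      right_inv := fun p => by ext1 <;> simp [mul_assoc] }
  let p : ℤ → S × S := fun k => (T ^ (k - 1)) (⟨x, hx⟩, ⟨y, hy⟩)
  have hp : ∀ k, p (k + 1) = T (p k) := fun k => by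
    simp only [p]
    rw [← Equiv.Perm.mul_apply, ← zpow_one_add]
    congr 2
    ring
  have hp1 : ∀ k, (p (k + 1)).1 = f ((p k).2 ^ 4) * (p k).1⁻¹ * c⁻¹ := fun k => by rw [hp]; rfl
  have hp2 : ∀ k, (p (k + 1)).2 = f (p (k + 1)).1 * (p k).2⁻¹ * c⁻¹ := fun k => by
    rw [hp1, hp]; rfl
  refine ⟨fun k => (p k).1, fun k => (p k).2, ⟨fun k => ?_, fun k => ?_⟩, ?_, ?_⟩
  · have := hf ((p k).2 ^ 4)
    have h : (p (k + 1)).1 * c * (p k).1 = f ((p k).2 ^ 4) := by rw [hp1]; group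
    rw [← h] at this
    simpa [c] using this
  · have := hf (p (k + 1)).1
    have h : (p (k + 1)).2 * c * (p k).2 = f (p (k + 1)).1 := by rw [hp2]; group
    rw [← h] at this
    simpa [c] using this
  · simp [p]
  · simp [p]

/-- Only the reference solution consists of units; the other one agrees with it at each stage, so
cancellation is by known units. -/
theorem IsPairSolution.eq {C : Aˣ} {o e : ℤ → Aˣ} {o' e' : ℤ → A}
    (h : IsPairSolution C (fun k => (o k : A)) (fun k => (e k : A)))
    (h' : IsPairSolution C o' e') (ho : o' 1 = o 1) (he : e' 1 = e 1) (k : ℤ) :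
    o' k = o k ∧ e' k = e k := by
  have hl : ∀ (u : Aˣ) {a b : A}, u * C * a = u * C * b → a = b := fun u a b hab => by
    rwa [← Units.val_mul, Units.mul_right_inj] at hab
  have hr : ∀ (u : Aˣ) {a b : A}, a * C * u = b * C * u → a = b := fun u a b hab => by
    rwa [Units.mul_left_inj, Units.mul_left_inj] at hab
  induction k using Int.inductionOn' (b := 1) with
  | zero => exact ⟨ho, he⟩
  | succ k _ ih =>
    have h1 : o' (k + 1) = o (k + 1) := by
      apply hr (o k)
      rw [← ih.1, h'.even, ih.1, ih.2, h.even]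
    refine ⟨h1, hr (e k) ?_⟩
    rw [← ih.2, h'.odd, ih.2, h.odd, h1]
  | pred k _ ih =>
    have h3 := h.odd (k - 1)
    have h4 := h'.odd (k - 1)
    have h5 := h.even (k - 1)
    have h6 := h'.even (k - 1)
    rw [sub_add_cancel] at h3 h4 h5 h6
    have h1 : e' (k - 1) = e (k - 1) := by
      apply hl (e k)
      rw [h3, ← ih.1, ← ih.2, h4]
    refine ⟨hl (o k) ?_, h1⟩
    rw [h5, ← h1, ← h6, ih.1]

end Existence

/-! ### Conserved quantity and linear recurrence -/

section Recurrence

variable {A : Type*} [Ring A] {C : Aˣ}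

/-- Carries the commutation relation to the next pair: in the system z C x is a polynomial in y. -/
theorem mul_eq_mul_mul_of_commute {x y z : Aˣ} (hc : Commute (y : A) (z * C * x : A))
    (h : x * y = y * C * x) : y * z = z * C * y := by
  have h1 : y * (z * C * x) = z * C * x * y := by
    ext
    simpa using hc.eq
  have h2 : y * z * (C * x) = z * C * y * (C * x) := by
    calc y * z * (C * x) = z * C * (x * y) := by rw [← mul_assoc (z * C), ← h1]; group
      _ = _ := by rw [h]; group
  exact mul_right_cancel h2

/-- The conserved quantity of the `(1, 4)` system in terms of consecutive solution entries `o`, `e`,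
the first one of odd index. -/
noncomputable def conserved (o e : Aˣ) : A :=
  e ^ 2 * ↑o⁻¹ + ↑e⁻¹ * (1 + o) * ↑e⁻¹ * (1 + ↑o⁻¹)

/-- The conserved quantity of the `(1, 4)` system in terms of consecutive solution entries `e`, `o`,
the second one of odd index. -/
noncomputable def conserved' (e o : Aˣ) : A :=
  ↑o⁻¹ * e ^ 2 + (1 + ↑o⁻¹) * ↑e⁻¹ * (1 + o) * ↑e⁻¹

theorem conserved_eq_conserved' {e o f : Aˣ} (h : (f * C * e : A) = 1 + o)
    (hc : e * o = o * C * e) : conserved o f = conserved' e o := by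
  obtain rfl : C = o⁻¹ * e * o * e⁻¹ := by
    rw [eq_mul_inv_iff_mul_eq, mul_assoc o⁻¹, hc]; group
  obtain ⟨w, rfl⟩ : ∃ w, f = w * o⁻¹ * e⁻¹ * o := ⟨f * o⁻¹ * e * o, by group⟩
  have hw : (1 + o : A) = w := by rw [← h]; simp [mul_assoc]
  have hw' : (1 + ↑o⁻¹ : A) = w * ↑o⁻¹ := by rw [← hw, add_mul, one_mul, Units.mul_inv, add_comm]
  rw [conserved, conserved', hw, hw', add_comm]
  simp only [pow_two, ← Units.val_mul]
  have hwo : o * w = w * o := by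
    ext
    rw [Units.val_mul, Units.val_mul, ← hw, mul_add, add_mul, mul_one, one_mul]
  -- The two summands trade places: the factors w cancel in one of them and reappear in the other.
  congr 1
  · exact congrArg Units.val (by group)
  · refine congrArg Units.val ?_
    calc _ = w * o⁻¹ * e⁻¹ * (o * w) * o⁻¹ * e⁻¹ := by group
      _ = _ := by rw [hwo]; group

section

variable {e o o' : Aˣ} (h : (o' * C * o : A) = 1 + e ^ 4) (hc : o * e = e * C * o)
include h hc

theorem exists_eq_mul_inv_mul_inv_mul : ∃ v : Aˣ, (v : A) = 1 + e ^ 4 ∧ v * e = e * v ∧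
    o' = v * e⁻¹ * o⁻¹ * e := by
  obtain rfl : C = e⁻¹ * o * e * o⁻¹ := by
    rw [eq_mul_inv_iff_mul_eq, mul_assoc e⁻¹, hc]; group
  refine ⟨o' * e⁻¹ * o * e, ?_, ?_, by group⟩
  · rw [← h]; simp [mul_assoc]
  · have : ((o' * e⁻¹ * o * e : Aˣ) : A) = 1 + e ^ 4 := by rw [← h]; simp [mul_assoc]
    generalize o' * e⁻¹ * o * e = v at this
    ext
    rw [Units.val_mul, Units.val_mul, this]
    simp [mul_add, add_mul, pow_succ, mul_assoc]

theorem conserved'_eq_conserved : conserved' e o' = conserved o e := by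
  obtain ⟨v, hv, hve, rfl⟩ := exists_eq_mul_inv_mul_inv_mul h hc
  have hve' : Commute v e⁻¹ := Commute.inv_right hve
  have t1 : (v * e⁻¹ * o⁻¹ * e)⁻¹ * (e⁻¹ * e⁻¹ * v) = e⁻¹ * o * e⁻¹ := by
    rw [mul_assoc e⁻¹ e⁻¹ v, ← hve'.eq, ← mul_assoc e⁻¹ v, ← hve'.eq]; group
  have t4 : (v * e⁻¹ * o⁻¹ * e)⁻¹ * e⁻¹ * (v * e⁻¹ * o⁻¹ * e) * e⁻¹ = e⁻¹ * o * e⁻¹ * o⁻¹ := by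
    have : e⁻¹ * (v * e⁻¹ * o⁻¹ * e) = v * e⁻¹ * (e⁻¹ * o⁻¹ * e) := by
      calc _ = e⁻¹ * v * (e⁻¹ * o⁻¹ * e) := by group
        _ = _ := by rw [← hve'.eq]
    rw [mul_assoc _ e⁻¹ (v * e⁻¹ * o⁻¹ * e), this]; group
  have t3 : e⁻¹ * (v * e⁻¹ * o⁻¹ * e) * e⁻¹ = e⁻¹ * v * e⁻¹ * o⁻¹ := by group
  set o' := v * e⁻¹ * o⁻¹ * e
  -- The two terms combine to o'⁻¹ e⁻² (1 + e⁴), where the factor v of o' cancels.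
  have s1 : (↑o'⁻¹ * ↑e⁻¹ * ↑e⁻¹ + ↑o'⁻¹ * e ^ 2 : A) = ↑e⁻¹ * o * ↑e⁻¹ := by
    have := congrArg Units.val t1
    simp only [Units.val_mul, hv] at this
    rw [← this]
    simp [mul_add, mul_assoc, pow_succ]
  have s4 := congrArg (Units.val) t4
  have s3 := congrArg (Units.val) t3
  simp only [Units.val_mul, hv] at s3 s4
  have e1 : conserved' e o' = (↑o'⁻¹ * ↑e⁻¹ * ↑e⁻¹ + ↑o'⁻¹ * e ^ 2) + ↑e⁻¹ * o' * ↑e⁻¹ +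
      ↑o'⁻¹ * ↑e⁻¹ * o' * ↑e⁻¹ + ↑e⁻¹ * ↑e⁻¹ := by
    rw [conserved']; noncomm_ring
  rw [e1, s1, s3, s4, conserved]
  simp only [mul_add, add_mul, mul_one, one_mul, mul_assoc, pow_succ, pow_zero,
    Units.inv_mul_cancel_left, Units.mul_inv_cancel_left]
  abel

theorem conserved'_mul {d f : Aˣ} (hd : (e * C * d : A) = 1 + o) (hf : (f * C * e : A) = 1 + o')
    (hc' : e * o' = o' * C * e) : conserved' e o' * e = f + C * d := by
  obtain ⟨v, hv, hve, ho'⟩ := exists_eq_mul_inv_mul_inv_mul h hc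
  have hCd : (C * d : A) = ↑e⁻¹ * (1 + o) := by rw [← hd]; simp [mul_assoc]
  have hCe : C * e = o'⁻¹ * e * o' := by rw [mul_assoc, hc']; group
  have hf' : (f : A) = (1 + ↑o'⁻¹) * ↑e⁻¹ * o' := by
    have : (f : A) = (1 + o') * ↑(C * e)⁻¹ := by
      rw [Units.eq_mul_inv_iff_mul_eq, Units.val_mul, ← mul_assoc, hf]
    rw [this, hCe]
    simp [add_mul, mul_assoc, add_comm]
  -- Cancelling v gives o'⁻¹ e⁻¹ + o'⁻¹ e³ = e⁻¹ o, the part of C d beyond e⁻¹.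
  have t : o'⁻¹ * e⁻¹ * v = e⁻¹ * o := by
    have hve' : Commute v e⁻¹ := Commute.inv_right hve
    rw [mul_assoc, ← hve'.eq, ho']; group
  have s := congrArg Units.val t
  simp only [Units.val_mul, hv] at s
  rw [hCd, hf', mul_add, ← s, conserved']
  simp only [mul_add, add_mul, mul_one, one_mul, mul_assoc, pow_succ, pow_zero,
    Units.inv_mul_cancel_left, Units.inv_mul]
  abel

end

theorem IsPairSolution.mul_comm_rel {o e : ℤ → Aˣ}
    (h : IsPairSolution C (fun k => (o k : A)) (fun k => (e k : A)))
    (h1 : o 1 * e 1 = e 1 * C * o 1) (n : ℕ) :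
    o (n + 1) * e (n + 1) = e (n + 1) * C * o (n + 1) ∧
      e (n + 1) * o (n + 1 + 1) = o (n + 1 + 1) * C * e (n + 1) := by
  have key : ∀ k, o k * e k = e k * C * o k → e k * o (k + 1) = o (k + 1) * C * e k := fun k hk =>
    mul_eq_mul_mul_of_commute
      (by rw [h.even]; exact (Commute.one_right _).add_right (Commute.self_pow _ _)) hk
  have : o (n + 1) * e (n + 1) = e (n + 1) * C * o (n + 1) := by
    induction n with
    | zero => simpa using h1
    | succ n ih =>
      push_cast
      exact mul_eq_mul_mul_of_commute
        (by rw [h.odd]; exact (Commute.one_right _).add_right (Commute.refl _)) (key _ ih)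
  exact ⟨this, key _ this⟩

theorem IsPairSolution.recurrence {o e : ℤ → Aˣ}
    (h : IsPairSolution C (fun k => (o k : A)) (fun k => (e k : A)))
    (h1 : o 1 * e 1 = e 1 * C * o 1) (n : ℕ) :
    (e (n + 2) : A) = conserved (o 1) (e 1) * e (n + 1) - C * e n := by
  have hD : ∀ n : ℕ, conserved (o (n + 1)) (e (n + 1)) = conserved (o 1) (e 1) := fun n => by
    induction n with
    | zero => simp
    | succ n ih =>
      rw [← ih, ← conserved'_eq_conserved (h.even _) (h.mul_comm_rel h1 n).1]
      push_cast
      exact conserved_eq_conserved' (h.odd _) (h.mul_comm_rel h1 n).2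
  have := conserved'_mul (h.even _) (h.mul_comm_rel h1 n).1 (h.odd _) (h.odd _)
    (h.mul_comm_rel h1 n).2
  rw [conserved'_eq_conserved (h.even _) (h.mul_comm_rel h1 n).1, hD] at this
  rw [this, add_assoc (n : ℤ) 1 1]
  simp

end Recurrence

/-! ### Positivity from the linear recurrence -/

section Positivity

variable {A : Type*} [Ring A] {P : Subsemiring A} {C a c m y δ : A} {E : ℕ → A}

/-- Since c a = C, the difference h_n = E (n + 1) - a E n satisfies h_{n+1} = c h_n + δ E (n + 1).
Tracking the leading terms a ^ n y and c ^ n m provides the monomials that later absorb the -1. -/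
theorem sub_mem_of_recurrence (ha : a ∈ P) (hc : c ∈ P) (hm : m ∈ P) (hy : y ∈ P) (hδ : δ ∈ P)
    (hca : c * a = C) (h0 : E 0 = y) (h1 : E 1 - a * y - m ∈ P)
    (h : ∀ n, E (n + 2) = (a + c + δ) * E (n + 1) - C * E n) (n : ℕ) :
    E n - a ^ n * y ∈ P ∧ E (n + 1) - a * E n - c ^ n * m ∈ P := by
  induction n with
  | zero => simpa [h0] using h1
  | succ n ih =>
    obtain ⟨ih1, ih2⟩ := ih
    have hE : E n ∈ P := by simpa using add_mem ih1 (mul_mem (pow_mem ha n) hy)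
    have hh : E (n + 1) - a * E n ∈ P := by simpa using add_mem ih2 (mul_mem (pow_mem hc n) hm)
    constructor
    · have : E (n + 1) - a ^ (n + 1) * y = (E (n + 1) - a * E n) + a * (E n - a ^ n * y) := by
        rw [pow_succ']; noncomm_ring
      rw [this]
      exact add_mem hh (mul_mem ha ih1)
    · have : E (n + 1 + 1) - a * E (n + 1) - c ^ (n + 1) * m =
          c * (E (n + 1) - a * E n - c ^ n * m) + δ * (E (n + 1) - a * E n) + δ * (a * E n) := by
        rw [h, ← hca, pow_succ']; noncomm_ring
      rw [this]
      exact add_mem (add_mem (mul_mem hc ih2) (mul_mem hδ hh)) (mul_mem hδ (mul_mem ha hE))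

theorem mem_of_recurrence (ha : a ∈ P) (hc : c ∈ P) (hm : m ∈ P) (hy : y ∈ P) (hδ : δ ∈ P)
    (hca : c * a = C) (h0 : E 0 = y) (h1 : E 1 - a * y - m ∈ P)
    (h : ∀ n, E (n + 2) = (a + c + δ) * E (n + 1) - C * E n) (n : ℕ) : E n ∈ P := by
  simpa using add_mem (sub_mem_of_recurrence ha hc hm hy hδ hca h0 h1 h n).1
    (mul_mem (pow_mem ha n) hy)

theorem mul_mul_sub_one_mem_of_recurrence (ha : a ∈ P) (hc : c ∈ P) (hm : m ∈ P) (hy : y ∈ P)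
    (hδ : δ ∈ P) (hca : c * a = C) (h0 : E 0 = y) (h1 : E 1 - a * y - m ∈ P)
    (h : ∀ n, E (n + 2) = (a + c + δ) * E (n + 1) - C * E n) (n : ℕ)
    (hone : c ^ n * m * C * (a ^ n * y) = 1) : E (n + 1) * C * E n - 1 ∈ P := by
  obtain ⟨h2, h3⟩ := sub_mem_of_recurrence ha hc hm hy hδ hca h0 h1 h n
  have hE := mem_of_recurrence ha hc hm hy hδ hca h0 h1 h n
  have hC : C ∈ P := hca ▸ mul_mem hc ha
  have h4 : E (n + 1) - c ^ n * m ∈ P := by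
    have := add_mem h3 (mul_mem ha hE)
    rwa [show E (n + 1) - a * E n - c ^ n * m + a * E n = E (n + 1) - c ^ n * m by abel] at this
  have : E (n + 1) * C * E n - 1 =
      (E (n + 1) - c ^ n * m) * C * E n + c ^ n * m * C * (E n - a ^ n * y) := by
    rw [← hone]; noncomm_ring
  rw [this]
  exact add_mem (mul_mem (mul_mem h4 hC) hE) (mul_mem (mul_mem (mul_mem (pow_mem hc n) hm) hC) h2)

end Positivity

/-! ### Application to the initial data -/

theorem isPairSolution_of_isSolution {R : ℤ → FreeSkewField} (h : IsSolution 1 4 R) :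
    IsPairSolution C (fun k => R (2 * k - 1)) (fun k => R (2 * k)) where
  even k := by
    have := h.even (2 * k) (even_two_mul k)
    rwa [show 2 * k + 1 = 2 * (k + 1) - 1 by ring] at this
  odd k := by
    have := h.odd (2 * (k + 1) - 1) ⟨k, by ring⟩
    rwa [pow_one, sub_add_cancel, show 2 * (k + 1) - 1 - 1 = 2 * k by ring] at this

theorem exists_isSolution_of_isPairSolution {o e : ℤ → FreeSkewField}
    (h : IsPairSolution C o e) :
    ∃ R, IsSolution 1 4 R ∧ (∀ k, R (2 * k - 1) = o k) ∧ ∀ k, R (2 * k) = e k := by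
  have ho : ∀ k, (fun n : ℤ => if Even n then e (n / 2) else o ((n + 1) / 2)) (2 * k - 1) = o k :=
    fun k => by
      have : ¬ Even (2 * k - 1) := Int.not_even_iff_odd.2 ⟨k - 1, by ring⟩
      simp [this]
  have he : ∀ k, (fun n : ℤ => if Even n then e (n / 2) else o ((n + 1) / 2)) (2 * k) = e k :=
    fun k => by simp
  generalize (fun n : ℤ => if Even n then e (n / 2) else o ((n + 1) / 2)) = R at ho he
  refine ⟨R, ⟨fun n hn => ?_, fun n hn => ?_⟩, ho, he⟩
  · obtain ⟨k, rfl⟩ := hn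
    have := h.odd k
    rw [← he, ← he, ← ho] at this
    convert this using 3
    · ring_nf
    · ring_nf
    · rw [pow_one]; ring_nf
  · obtain ⟨k, rfl⟩ := hn
    have := h.even k
    rw [← ho, ← ho, ← he] at this
    convert this using 3
    · ring_nf
    · ring_nf
    · ring_nf

theorem hasInitialData_iff {R : ℤ → FreeSkewField} :
    HasInitialData R ↔ R 1 = (Y * X * Y⁻¹ : FreeSkewFieldˣ) ∧ R 2 = Y := by
  have : Y * X * Y⁻¹ = C⁻¹ * X := by simp [C, mul_assoc]
  rw [HasInitialData, this, Units.val_mul, Units.eq_inv_mul_iff_mul_eq]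

theorem X_mem_range_monomial : X ∈ monomial.range := gen_mem_range_monomial 0

theorem Y_mem_range_monomial : Y ∈ monomial.range := gen_mem_range_monomial 1

theorem conserved_initial : conserved (Y * X * Y⁻¹) Y =
    ((Y ^ 3 * X⁻¹ * Y⁻¹ : FreeSkewFieldˣ) + (X * Y⁻¹ * Y⁻¹ : FreeSkewFieldˣ) +
      ((Y⁻¹ * Y⁻¹ : FreeSkewFieldˣ) + (Y⁻¹ * X⁻¹ * Y⁻¹ : FreeSkewFieldˣ) +
        (X * Y⁻¹ * X⁻¹ * Y⁻¹ : FreeSkewFieldˣ)) : FreeSkewField) := by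
  simp [conserved, mul_add, add_mul, mul_assoc, pow_succ]
  abel

section

variable {o e : ℤ → FreeSkewFieldˣ}
  (h : IsPairSolution C (fun k => (o k : FreeSkewField)) (fun k => (e k : FreeSkewField)))
  (ho : o 1 = Y * X * Y⁻¹) (he : e 1 = Y)
include h ho he

theorem C_mul_initial : (C * e 0 : FreeSkewField) = ↑(Y⁻¹) + ↑(X * Y⁻¹) := by
  have := h.odd 0
  simp only [zero_add, ho, he] at this
  rw [mul_assoc, ← Units.eq_inv_mul_iff_mul_eq] at this
  rw [this]
  simp [mul_add, mul_assoc]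

theorem even_zero_mem_positiveLaurent : (e 0 : FreeSkewField) ∈ positiveLaurent := by
  have hX := X_mem_range_monomial
  have hY := Y_mem_range_monomial
  have hC : C ∈ monomial.range :=
    mul_mem (mul_mem (mul_mem hX hY) (inv_mem hX)) (inv_mem hY)
  rw [Units.eq_inv_mul_iff_mul_eq _ |>.2 (C_mul_initial h ho he)]
  exact mul_mem (coe_mem_positiveLaurent_of_mem_range (inv_mem hC))
    (add_mem (coe_mem_positiveLaurent_of_mem_range (inv_mem hY))
      (coe_mem_positiveLaurent_of_mem_range (mul_mem hX (inv_mem hY))))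

theorem mem_positiveLaurent (n : ℕ) : (e (n + 1) : FreeSkewField) ∈ positiveLaurent ∧
    (o (n + 2) : FreeSkewField) ∈ positiveLaurent := by
  have hX := X_mem_range_monomial
  have hY := Y_mem_range_monomial
  have hX' := inv_mem hX
  have hY' := inv_mem hY
  have hP := fun u (hu : u ∈ monomial.range) => coe_mem_positiveLaurent_of_mem_range hu
  have ha := hP _ (mul_mem (mul_mem (pow_mem hY 3) hX') hY')
  have hc := hP _ (mul_mem (mul_mem hX hY') hY')
  have hm := hP _ (mul_mem (mul_mem hX hY') hX')
  have hδ := add_mem (add_mem (hP _ (mul_mem hY' hY')) (hP _ (mul_mem (mul_mem hY' hX') hY')))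
    (hP _ (mul_mem (mul_mem (mul_mem hX hY') hX') hY'))
  have hca : ((X * Y⁻¹ * Y⁻¹ : FreeSkewFieldˣ) * (Y ^ 3 * X⁻¹ * Y⁻¹ : FreeSkewFieldˣ) :
      FreeSkewField) = C := by
    rw [← Units.val_mul, C]; congr 1; group
  have hcomm : o 1 * e 1 = e 1 * C * o 1 := by rw [ho, he, C]; group
  have hrec : ∀ k : ℕ, (e ((k + 2 : ℕ) + 1) : FreeSkewField) =
      ((Y ^ 3 * X⁻¹ * Y⁻¹ : FreeSkewFieldˣ) + (X * Y⁻¹ * Y⁻¹ : FreeSkewFieldˣ) +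
        ((Y⁻¹ * Y⁻¹ : FreeSkewFieldˣ) + (Y⁻¹ * X⁻¹ * Y⁻¹ : FreeSkewFieldˣ) +
          (X * Y⁻¹ * X⁻¹ * Y⁻¹ : FreeSkewFieldˣ))) * e ((k + 1 : ℕ) + 1) - C * e (k + 1) := fun k => by
    have := h.recurrence hcomm (k + 1)
    rw [ho, he, conserved_initial] at this
    push_cast at this ⊢
    rw [add_right_comm (k : ℤ) 2 1]
    exact this
  have h1 : (e ((1 : ℕ) + 1) : FreeSkewField) - (Y ^ 3 * X⁻¹ * Y⁻¹ : FreeSkewFieldˣ) * Y -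
      (X * Y⁻¹ * X⁻¹ : FreeSkewFieldˣ) = ↑(Y⁻¹ * X⁻¹) := by
    have := h.recurrence hcomm 0
    simp only [Nat.cast_zero, zero_add] at this
    rw [C_mul_initial h ho he, ho, he, conserved_initial] at this
    rw [Nat.cast_one, one_add_one_eq_two, this]
    simp [add_mul, mul_assoc]
    abel
  have h1' := h1 ▸ hP _ (mul_mem hY' hX')
  have hone : (((X * Y⁻¹ * Y⁻¹ : FreeSkewFieldˣ) : FreeSkewField) ^ n *
      (X * Y⁻¹ * X⁻¹ : FreeSkewFieldˣ) * C *
      (((Y ^ 3 * X⁻¹ * Y⁻¹ : FreeSkewFieldˣ) : FreeSkewField) ^ n * Y)) = 1 := by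
    have : (X * Y⁻¹ * Y⁻¹) ^ n * (X * Y⁻¹ * X⁻¹) * C * ((Y ^ 3 * X⁻¹ * Y⁻¹) ^ n * Y) = 1 := by
      -- The monomial a is a conjugate by Y of c⁻¹, so the n-th powers cancel around m C Y = 1.
      have h2 : Y ^ 3 * X⁻¹ * Y⁻¹ = Y * (X * Y⁻¹ * Y⁻¹)⁻¹ * Y⁻¹ := by group
      have h3 : X * Y⁻¹ * X⁻¹ * C * Y = 1 := by rw [C]; group
      rw [h2, conj_pow, inv_pow]
      generalize (X * Y⁻¹ * Y⁻¹) ^ n = c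
      calc _ = c * (X * Y⁻¹ * X⁻¹ * C * Y) * c⁻¹ := by group
        _ = 1 := by rw [h3]; group
    simpa using congrArg Units.val this
  have h0 : (e ((0 : ℕ) + 1) : FreeSkewField) = Y := by simp [he]
  refine ⟨mem_of_recurrence (E := fun k : ℕ => (e (k + 1) : FreeSkewField)) ha hc hm (hP _ hY) hδ
    hca h0 h1' hrec n, ?_⟩
  have := mul_mul_sub_one_mem_of_recurrence (E := fun k : ℕ => (e (k + 1) : FreeSkewField)) ha hc hm
    (hP _ hY) hδ hca h0 h1' hrec n hone
  have h3 := h.odd (n + 1)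
  push_cast at this
  rwa [h3, add_sub_cancel_left, add_assoc (n : ℤ), one_add_one_eq_two] at this

end

end NCCluster

open NCCluster in
theorem mainTheorem11 :
    (∃! R : ℤ → FreeSkewField, IsSolution 1 4 R ∧ HasInitialData R) ∧
      ∀ R : ℤ → FreeSkewField, IsSolution 1 4 R → HasInitialData R →
        ∀ n : ℤ, 0 ≤ n → IsPositiveLaurent (R n) := by
  have hX : X ∈ positiveUnits := gen_mem_positiveUnits 0
  have hY : Y ∈ positiveUnits := gen_mem_positiveUnits 1
  obtain ⟨o, e, h, ho, he⟩ := exists_isPairSolution C positiveUnits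
    (fun _ hu _ hv => exists_mem_positiveUnits_eq_add hu hv)
    (mul_mem (mul_mem (mul_mem hX hY) (inv_mem hX)) (inv_mem hY))
    (mul_mem (mul_mem hY hX) (inv_mem hY)) hY
  have huniq : ∀ R, IsSolution 1 4 R → HasInitialData R →
      ∀ k, R (2 * k - 1) = o k ∧ R (2 * k) = e k := fun R hR hR' => by
    rw [hasInitialData_iff] at hR'
    exact h.eq (isPairSolution_of_isSolution hR) (by rw [ho]; exact hR'.1)
      (by rw [he]; exact hR'.2)
  refine ⟨?_, fun R hR hR' n hn => ?_⟩
  · obtain ⟨R, hR, hRo, hRe⟩ := exists_isSolution_of_isPairSolution h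
    refine ⟨R, ⟨hR, hasInitialData_iff.2 ⟨?_, ?_⟩⟩, fun R' hR' => funext fun n => ?_⟩
    · simpa [ho] using hRo 1
    · simpa [he] using hRe 1
    · have hu := huniq R' hR'.1 hR'.2
      obtain ⟨k, rfl | rfl⟩ := n.even_or_odd'
      · rw [(hu k).2, hRe]
      · rw [show 2 * k + 1 = 2 * (k + 1) - 1 by ring, (hu _).1, hRo]
  · rw [isPositiveLaurent_iff]
    have hu := huniq R hR hR'
    have hX := X_mem_range_monomial
    have hY := Y_mem_range_monomial
    obtain ⟨k, rfl | rfl⟩ := n.even_or_odd'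
    · rw [(hu k).2]
      obtain ⟨k, rfl⟩ := Int.eq_ofNat_of_zero_le (show 0 ≤ k by omega)
      cases k with
      | zero => exact even_zero_mem_positiveLaurent h ho he
      | succ k => exact_mod_cast (mem_positiveLaurent h ho he k).1
    · rw [show 2 * k + 1 = 2 * (k + 1) - 1 by ring, (hu _).1]
      obtain ⟨k, rfl⟩ := Int.eq_ofNat_of_zero_le (show 0 ≤ k by omega)
      cases k with
      | zero =>
        simp only [Nat.cast_zero, zero_add, ho]
        exact coe_mem_positiveLaurent_of_mem_range (mul_mem (mul_mem hY hX) (inv_mem hY))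
      | succ k =>
        have := (mem_positiveLaurent h ho he k).2
        rwa [show (k : ℤ) + 2 = ((k + 1 : ℕ) : ℤ) + 1 by push_cast; ring] at this
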